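/- **Setting.** Let $(\mathscr V,\mathscr E)$ be a finite directed graph whose vertices are split into generators $\mathcal G$ and loads $\mathcal L=\mathscr V\setminus\mathcal G$. Each edge $e$ is a transmission line, identified with $[0,\ell_e]$, $\ell_e>0$ (with $0$ at its start vertex and $\ell_e$ at its end vertex), and has parameters $R_e,L_e,G_e,C_e>0$. Let $s(e,v)=1$ if $v$ is the end of $e$ and $s(e,v)=-1$ if $v$ is the start of $e$, let $\mathscr E_v$ be the set of edges connected to $v$, and let $x_v$ denote the endpoint of an edge of $\mathscr E_v$ at $v$. Given functions $v_g$ ($g\in\mathcal G$) and $i_l$ ($l\in\mathcal L$) on $[0,\infty)$, consider for $u_e=(u_e^1,u_e^2)$ (voltage and current) the network problem $$\partial_t u_e=-A_e\partial_x u_e-F_eu_e\quad(e\in\mathscr E),\qquad A_e=\begin{pmatrix}0&1/C_e\\1/L_e&0\end{pmatrix},\quad F_e=\begin{pmatrix}G_e/C_e&0\\0&R_e/L_e\end{pmatrix},$$ with $u_e(0,\cdot)=(u_0)_e$ and, for all $t\ge 0$, the coupling conditions $$u^1_e(t,x_v)=u^1_f(t,x_v)\ \ (v\in\mathscr V,\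 e,f\in\mathscr E_v),\qquad u^1_e(t,x_g)=v_g(t)\ \ (g\in\mathcal G,\ e\in\mathscr E_g),\qquad \sum_{e\in\mathscr E_l}s(e,l)\,u^2_e(t,x_l)=i_l(t)\ \ (l\in\mathcal L).$$ A solution is a function $u$ on $[0,\infty)$ with $u_e(t)\in H^1((0,\ell_e),\mathbb R^2)$ for all $t\ge0$ and $e\in\mathscr E$ (identified with its continuous representative), continuously differentiable in $t$ with values in $\prod_e L^2((0,\ell_e),\mathbb R^2)$, which satisfies the equations, the initial condition and the coupling conditions. **Proposition.** Suppose that all lines have identical parameters, $(R_e,L_e,G_e,C_e)=(R,L,G,C)$ for all $e\in\mathscr E$. Then there are constants $K,\mu>0$, depending only on the network (the graph, the choice of generators, the lengths $\ell_e$ and $R,L,G,C$), such that the following holds. Let $v_g$ ($g\in\mathcal G$) and $i_l$ ($l\in\mathcal L$) be continuously differentiable on $[0,\infty)$, let $u_0,w_0\in\prod_e H^2((0,\ell_e),\mathbb R^2)$, and let $u$ and $w$ be solutions of the network problem with these same coupling data $v_g,i_l$ and with initial data $u_0$ and $w_0$, respectively. Then for all $t\ge0$ $$\max_{e\in\mathscr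 E}\ \sup_{x\in[0,\ell_e]}\ \max_{k=1,2}\ |u^k_e(t,x)-w^k_e(t,x)|\ \le\ K e^{-\mu t}\,\|u_0-w_0\|_{H^1}.$$ That is, any two solutions with the same coupling data approach each other exponentially in the supremum norm. -/

import Mathlib

open MeasureTheory Filter Topology Set
open scoped ContDiff

noncomputable section

/-- A power network: a finite directed graph with edge set `E` and vertex set `V`. Each edge `e` is
a transmission line, identified with `[0, len e]` (the point `0` being its start `src e` and
`len e` its end `tgt e`), with line parameters `R e, L e, G e, C e > 0`. The vertices in `gen`
are the generators, all the other vertices are the loads. -/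
structure PowerNetwork (V E : Type*) where
  src : E → V
  tgt : E → V
  gen : Set V
  len : E → ℝ
  R : E → ℝ
  L : E → ℝ
  G : E → ℝ
  C : E → ℝ
  len_pos : ∀ e, 0 < len e
  R_pos : ∀ e, 0 < R e
  L_pos : ∀ e, 0 < L e
  G_pos : ∀ e, 0 < G e
  C_pos : ∀ e, 0 < C e

/-- A state on the network with edge set `E`: on every edge `e`, the voltage `z e 0` and the
current `z e 1`, as functions of the position `x` on the edge. -/
abbrev NetState (E : Type*) := E → Fin 2 → ℝ → ℝ

/-- `f ∈ H¹(0, ℓ)`, for the continuous representative `f` on `[0, ℓ]`: `f` is absolutely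
continuous on `[0, ℓ]` and its (almost everywhere defined) derivative, which is then its weak
derivative, is in `L²(0, ℓ)`. -/
def InH1 (ℓ : ℝ) (f : ℝ → ℝ) : Prop :=
  AbsolutelyContinuousOnInterval f 0 ℓ ∧ MemLp (deriv f) 2 (volume.restrict (Icc 0 ℓ))

/-- `f ∈ H²(0, ℓ)`: both `f` and its weak derivative are in `H¹(0, ℓ)`. -/
def InH2 (ℓ : ℝ) (f : ℝ → ℝ) : Prop :=
  InH1 ℓ f ∧ ∃ g : ℝ → ℝ, InH1 ℓ g ∧ deriv f =ᵐ[volume.restrict (Icc 0 ℓ)] g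

namespace PowerNetwork

variable {V E : Type*} (N : PowerNetwork V E)

/-- The matrix `A_e` of the Telegrapher's equations on the line `e`. -/
def A (e : E) : Matrix (Fin 2) (Fin 2) ℝ := !![0, 1 / N.C e; 1 / N.L e, 0]

/-- The matrix `F_e` of the Telegrapher's equations on the line `e`. -/
def F (e : E) : Matrix (Fin 2) (Fin 2) ℝ := !![N.G e / N.C e, 0; 0, N.R e / N.L e]

/-- The operator `u ↦ -A_e ∂ₓ u_e - F_e u_e`. -/
def op (z : NetState E) : NetState E := fun e k x =>
  -(∑ j, N.A e k j * deriv (z e j) x) - ∑ j, N.F e k j * z e j x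

/-! The ends of the lines: `(e, false)` is the start of `e` and `(e, true)` is its end. -/

/-- The vertex at an end of a line. -/
def node : E × Bool → V
  | (e, false) => N.src e
  | (e, true) => N.tgt e

/-- The coordinate of an end of a line. -/
def pos : E × Bool → ℝ
  | (_, false) => 0
  | (e, true) => N.len e

/-- The sign `s(e, v)` of the end of `e` at `v`: `-1` at the start of `e` and `1` at its end. -/
def sgn (_ : PowerNetwork V E) : E × Bool → ℝ
  | (_, false) => -1
  | (_, true) => 1

/-- The voltage of `z` at an end of a line. -/
def endVoltage (z : NetState E) (p : E × Bool) : ℝ := z p.1 0 (N.pos p)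

/-- The current of `z` at an end of a line. -/
def endCurrent (z : NetState E) (p : E × Bool) : ℝ := z p.1 1 (N.pos p)

/-- A state all of whose components are in `H¹`. -/
def StateInH1 (z : NetState E) : Prop := ∀ e k, InH1 (N.len e) (z e k)

/-- A state all of whose components are in `H²`. -/
def StateInH2 (z : NetState E) : Prop := ∀ e k, InH2 (N.len e) (z e k)

/-- The `L²` distance of two states on the component `k` of the edge `e`. -/
def edgeDist (e : E) (k : Fin 2) (z z' : NetState E) : ENNReal :=
  eLpNorm (fun x => z e k x - z' e k x) 2 (volume.restrict (Icc 0 (N.len e)))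

/-- The `H¹` norm of a state (meaningful for states in `H¹`). -/
def h1Norm [Fintype E] (z : NetState E) : ℝ :=
  Real.sqrt (∑ e, ∑ k, ∫ x in (0 : ℝ)..N.len e, ((z e k x) ^ 2 + (deriv (z e k) x) ^ 2))

/-- `u` is a solution on `[0, ∞)` of the initial-boundary value problem on the network
with initial state `u₀`, generator voltages `v_g` and load currents `i_l`: a classical solution of
the evolution equation `u' = op u` in `L²` (`u(t) ∈ H¹` for all `t ≥ 0`, and `u` is continuously
differentiable with values in `L²`), which satisfies the initial condition and the coupling
conditions. -/
structure IsSolution [Fintype E] [DecidableEq V] (vg il : V → ℝ → ℝ) (u₀ : NetState E)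
    (u : ℝ → NetState E) : Prop where
  mem_H1 : ∀ t, 0 ≤ t → N.StateInH1 (u t)
  /-- The time derivative in `L²` (one-sided at `t = 0`) is given by the equations. -/
  evolution : ∀ t, 0 ≤ t → ∀ e k,
    Tendsto (fun s => N.edgeDist e k ((s - t)⁻¹ • (u s - u t)) (N.op (u t)))
      (𝓝[Ici 0 \ {t}] t) (𝓝 0)
  /-- The time derivative is continuous with values in `L²`. -/
  deriv_continuous : ∀ t, 0 ≤ t → ∀ e k,
    Tendsto (fun s => N.edgeDist e k (N.op (u s)) (N.op (u t))) (𝓝[Ici 0] t) (𝓝 0)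
  initial : ∀ e k, ∀ x ∈ Icc 0 (N.len e), u 0 e k x = u₀ e k x
  /-- The voltages of all the lines meeting at a vertex agree there. -/
  voltage_continuous : ∀ t, 0 ≤ t → ∀ p q, N.node p = N.node q →
    N.endVoltage (u t) p = N.endVoltage (u t) q
  /-- At a generator the voltage is prescribed. -/
  generator : ∀ t, 0 ≤ t → ∀ p, N.node p ∈ N.gen → N.endVoltage (u t) p = vg (N.node p) t
  /-- At a load the net current is prescribed. -/
  load : ∀ t, 0 ≤ t → ∀ l, l ∉ N.gen →
    ∑ p with N.node p = l, N.sgn p * N.endCurrent (u t) p = il l t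

end PowerNetwork

end

/-!
The difference `z` of two solutions with the same coupling data is a solution with homogeneous
coupling conditions, and the claim is that such a `z` decays exponentially in the supremum norm.

The weighted `L²` norm `energy z = ∑ₑ ∫ Cₑ (zₑ⁰)² + Lₑ (zₑ¹)²` decays. Integrating by parts on each
line (`StateInH1.integral_mul_op`), its time derivative is the loss `-2 ∑ₑ ∫ Gₑ (zₑ⁰)² + Rₑ (zₑ¹)²`
plus boundary terms, and these cancel: grouped by vertices, they are the common voltage at the
vertex times the net current, one of which vanishes (`sum_power_eq_zero`). As `μ C ≤ G` and
`μ L ≤ R` for some `μ > 0`, the energy is at most `exp (-2 μ t)` times its initial value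
(`IsTrajectory.energy_le`).

The supremum norm needs control of `∂ₓ z`, and by the equations it is enough to control the time
derivative `op z`. This is not known to be differentiable in time, so it cannot be put into the
energy identity. However, for `h > 0` the difference `z (t + h) - z t` is again a homogeneous
solution; dividing the decay of its energy by `h²` and letting `h` tend to `0` gives the decay of
`energy (op z)` (`IsTrajectory.energy_op_le`). Finally `energy z + energy (op z)` is equivalent to
the square of the `H¹` norm (`StateInH1.lineH1Sq_le`, `StateInH1.lineEnergy_add_le`), which bounds
the supremum norm by the one-dimensional Sobolev embedding (`InH1.sq_le`).
-/

/-! ### Curves in `L²` -/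

/-- The class of `f` in `L²(ν)`, with the junk value `0` if `f` is not square integrable. -/
noncomputable def toL2 (ν : Measure ℝ) (f : ℝ → ℝ) : Lp ℝ 2 ν :=
  open Classical in if h : MemLp f 2 ν then h.toLp f else 0

section L2

variable {ν : Measure ℝ} {f g : ℝ → ℝ}

lemma toL2_of_memLp (hf : MemLp f 2 ν) : toL2 ν f = hf.toLp f := dif_pos hf

lemma coeFn_toL2 (hf : MemLp f 2 ν) : toL2 ν f =ᵐ[ν] f := by
  rw [toL2_of_memLp hf]; exact hf.coeFn_toLp

lemma toL2_sub (hf : MemLp f 2 ν) (hg : MemLp g 2 ν) :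
    toL2 ν (f - g) = toL2 ν f - toL2 ν g := by
  rw [toL2_of_memLp hf, toL2_of_memLp hg, toL2_of_memLp (hf.sub hg), MemLp.toLp_sub]

lemma toL2_const_smul (c : ℝ) (hf : MemLp f 2 ν) : toL2 ν (c • f) = c • toL2 ν f := by
  rw [toL2_of_memLp hf, toL2_of_memLp (hf.const_smul c), MemLp.toLp_const_smul]

lemma toL2_congr_ae (hf : MemLp f 2 ν) (hfg : f =ᵐ[ν] g) : toL2 ν f = toL2 ν g := by
  rw [toL2_of_memLp hf, toL2_of_memLp (hf.ae_eq hfg)]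
  exact (MemLp.toLp_eq_toLp_iff _ _).2 hfg

lemma inner_toL2 (hf : MemLp f 2 ν) (hg : MemLp g 2 ν) :
    inner ℝ (toL2 ν f) (toL2 ν g) = ∫ x, f x * g x ∂ν := by
  rw [L2.inner_def]
  refine integral_congr_ae ?_
  filter_upwards [coeFn_toL2 hf, coeFn_toL2 hg] with x h1 h2
  rw [h1, h2]; simp [mul_comm]

lemma norm_sq_toL2 (hf : MemLp f 2 ν) : ‖toL2 ν f‖ ^ 2 = ∫ x, f x ^ 2 ∂ν := by
  rw [← real_inner_self_eq_norm_sq, inner_toL2 hf hf]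
  simp only [sq]

/-- Convergence of difference quotients in the `L²` seminorm is differentiability of the curve of
classes in `L²`. -/
lemma hasDerivWithinAt_toL2 {f : ℝ → ℝ → ℝ} {s : Set ℝ} {t : ℝ} (ht : t ∈ s)
    (hf : ∀ r ∈ s, MemLp (f r) 2 ν) (hg : MemLp g 2 ν)
    (h : Tendsto (fun r => eLpNorm (fun x => ((r - t)⁻¹ • (f r - f t)) x - g x) 2 ν)
      (𝓝[s \ {t}] t) (𝓝 0)) :
    HasDerivWithinAt (fun r => toL2 ν (f r)) (toL2 ν g) s t := by
  rw [hasDerivWithinAt_iff_tendsto_slope, tendsto_iff_edist_tendsto_0]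
  refine h.congr' ?_
  filter_upwards [self_mem_nhdsWithin] with r hr
  have h1 := (hf r hr.1).sub (hf t ht)
  have h2 := h1.const_smul (r - t)⁻¹
  rw [slope_def_module, ← toL2_sub (hf r hr.1) (hf t ht), ← toL2_const_smul _ h1,
    toL2_of_memLp h2, toL2_of_memLp hg, Lp.edist_toLp_toLp]
  rfl

end L2

/-! ### Functions in `H¹` of an interval -/

section H1

variable {ℓ : ℝ} {f g : ℝ → ℝ}

lemma InH1.continuousOn (hℓ : 0 ≤ ℓ) (hf : InH1 ℓ f) : ContinuousOn f (Icc 0 ℓ) := by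
  simpa [uIcc_of_le hℓ] using hf.1.continuousOn

lemma InH1.memLp (hℓ : 0 ≤ ℓ) (hf : InH1 ℓ f) : MemLp f 2 (volume.restrict (Icc 0 ℓ)) := by
  have hc := hf.continuousOn hℓ
  obtain ⟨M, hM⟩ := isCompact_Icc.exists_bound_of_continuousOn hc
  refine MemLp.of_bound (hc.aestronglyMeasurable measurableSet_Icc) M ?_
  filter_upwards [ae_restrict_mem measurableSet_Icc] with x hx using hM x hx

lemma InH1.ae_differentiableAt (hℓ : 0 ≤ ℓ) (hf : InH1 ℓ f) :
    ∀ᵐ x ∂volume.restrict (Icc 0 ℓ), DifferentiableAt ℝ f x := by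
  rw [ae_restrict_iff' measurableSet_Icc]
  simpa [uIcc_of_le hℓ] using hf.1.ae_differentiableAt

lemma InH1.deriv_sub_ae (hℓ : 0 ≤ ℓ) (hf : InH1 ℓ f) (hg : InH1 ℓ g) :
    deriv (f - g) =ᵐ[volume.restrict (Icc 0 ℓ)] deriv f - deriv g := by
  filter_upwards [hf.ae_differentiableAt hℓ, hg.ae_differentiableAt hℓ] with x h1 h2
  exact deriv_sub h1 h2

lemma InH1.sub (hℓ : 0 ≤ ℓ) (hf : InH1 ℓ f) (hg : InH1 ℓ g) : InH1 ℓ (f - g) :=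
  ⟨hf.1.sub hg.1, (hf.2.sub hg.2).ae_eq (hf.deriv_sub_ae hℓ hg).symm⟩

lemma setIntegral_Icc_eq_intervalIntegral (hℓ : 0 ≤ ℓ) (f : ℝ → ℝ) :
    ∫ x in Icc 0 ℓ, f x = ∫ x in (0 : ℝ)..ℓ, f x := by
  rw [integral_Icc_eq_integral_Ioc, intervalIntegral.integral_of_le hℓ]

lemma InH1.integral_mul_deriv_add (hℓ : 0 ≤ ℓ) (hf : InH1 ℓ f) (hg : InH1 ℓ g) :
    ∫ x in Icc 0 ℓ, (deriv f x * g x + f x * deriv g x) = f ℓ * g ℓ - f 0 * g 0 := by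
  rw [setIntegral_Icc_eq_intervalIntegral hℓ]
  exact hf.1.integral_deriv_mul_eq_sub hg.1

/-- The Sobolev embedding of `H¹(0, ℓ)` into the bounded functions: integrate
`f(x)² - f(y)² = ∫ 2 f f'` over `y`. -/
lemma InH1.sq_le (hℓ : 0 < ℓ) (hf : InH1 ℓ f) {x : ℝ} (hx : x ∈ Icc 0 ℓ) :
    f x ^ 2 ≤ (1 / ℓ + 1) *
      ((∫ y in Icc 0 ℓ, f y ^ 2) + ∫ y in Icc 0 ℓ, deriv f y ^ 2) := by
  have i1 := (hf.memLp hℓ.le).integrable_sq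
  have i2 := hf.2.integrable_sq
  set S := (∫ y in Icc 0 ℓ, f y ^ 2) + ∫ y in Icc 0 ℓ, deriv f y ^ 2 with hS
  have key : ∀ y ∈ Icc 0 ℓ, f x ^ 2 ≤ f y ^ 2 + S := by
    intro y hy
    have hsub : uIcc y x ⊆ uIcc 0 ℓ := by
      rw [uIcc_of_le hℓ.le]; exact uIcc_subset_Icc hy hx
    have hac := hf.1.mono hsub
    have h1 := hac.integral_deriv_mul_eq_sub hac
    have hsub' : uIoc y x ⊆ Icc 0 ℓ := uIoc_subset_uIcc.trans (by rwa [uIcc_of_le hℓ.le] at hsub)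
    have h2 : |∫ r in y..x, deriv f r * f r + f r * deriv f r| ≤ S := by
      rw [← Real.norm_eq_abs]
      refine (intervalIntegral.norm_integral_le_integral_norm_uIoc).trans ?_
      rw [hS, ← integral_add i1 i2]
      refine le_trans ?_ (setIntegral_mono_set (i1.add i2) (ae_of_all _ fun r => ?_)
        hsub'.eventuallyLE)
      · refine integral_mono_of_nonneg (ae_of_all _ fun r => norm_nonneg _)
          ((i1.add i2).mono_measure (Measure.restrict_mono hsub' le_rfl)) (ae_of_all _ fun r => ?_)
        simp only [Real.norm_eq_abs, abs_le]
        constructor <;> nlinarith [sq_nonneg (f r + deriv f r), sq_nonneg (f r - deriv f r)]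
      · simp only [Pi.zero_apply]; positivity
    rw [h1] at h2
    nlinarith [(abs_le.1 h2).2]
  have hmono : ∫ y in Icc 0 ℓ, f x ^ 2 ≤ ∫ y in Icc 0 ℓ, (f y ^ 2 + S) :=
    setIntegral_mono_on (integrable_const _) (i1.add (integrable_const _)) measurableSet_Icc key
  rw [integral_add i1 (integrable_const _)] at hmono
  simp only [integral_const, measureReal_restrict_apply_univ, Real.volume_real_Icc, sub_zero,
    max_eq_left hℓ.le, smul_eq_mul] at hmono
  have hS2 : (∫ y in Icc 0 ℓ, f y ^ 2) ≤ S := by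
    rw [hS]; exact le_add_of_nonneg_right (integral_nonneg fun _ => sq_nonneg _)
  rw [show (1 / ℓ + 1) * S = (S + ℓ * S) / ℓ by field_simp, le_div_iff₀ hℓ]
  linarith

end H1

namespace PowerNetwork

variable {V E : Type*} {N : PowerNetwork V E}

/-! ### The evolution operator and the coupling conditions -/

lemma op_zero (z : NetState E) (e : E) :
    N.op z e 0 = fun x => -(1 / N.C e * deriv (z e 1) x) - N.G e / N.C e * z e 0 x := by
  funext x; simp [op, A, F]

lemma op_one (z : NetState E) (e : E) :
    N.op z e 1 = fun x => -(1 / N.L e * deriv (z e 0) x) - N.R e / N.L e * z e 1 x := by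
  funext x; simp [op, A, F]

lemma StateInH1.memLp {z : NetState E} (hz : N.StateInH1 z) (e : E) (k : Fin 2) :
    MemLp (z e k) 2 (volume.restrict (Icc 0 (N.len e))) :=
  (hz e k).memLp (N.len_pos e).le

lemma StateInH1.memLp_op {z : NetState E} (hz : N.StateInH1 z) (e : E) (k : Fin 2) :
    MemLp (N.op z e k) 2 (volume.restrict (Icc 0 (N.len e))) := by
  fin_cases k
  · simp only [Fin.zero_eta, op_zero]
    exact ((hz e 1).2.const_mul _).neg.sub ((hz.memLp e 0).const_mul _)
  · simp only [Fin.mk_one, op_one]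
    exact ((hz e 0).2.const_mul _).neg.sub ((hz.memLp e 1).const_mul _)

lemma StateInH1.sub {z z' : NetState E} (hz : N.StateInH1 z) (hz' : N.StateInH1 z') :
    N.StateInH1 (z - z') := fun e k => (hz e k).sub (N.len_pos e).le (hz' e k)

lemma StateInH1.op_sub_ae {z z' : NetState E} (hz : N.StateInH1 z) (hz' : N.StateInH1 z')
    (e : E) (k : Fin 2) :
    N.op (z - z') e k =ᵐ[volume.restrict (Icc 0 (N.len e))] N.op z e k - N.op z' e k := by
  have h := fun j => (hz e j).deriv_sub_ae (N.len_pos e).le (hz' e j)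
  filter_upwards [h 0, h 1] with x h0 h1
  simp only [op, Fin.sum_univ_two, Pi.sub_apply] at *
  rw [h0, h1]; ring

/-- A solution of the network problem without prescribed initial state, as a differentiable curve
in `L²`; the derivative within `Ici 0` is one-sided at `t = 0`. -/
structure IsTrajectory [Fintype E] [DecidableEq V] (N : PowerNetwork V E) (vg il : V → ℝ → ℝ)
    (z : ℝ → NetState E) : Prop where
  mem_H1 : ∀ t, 0 ≤ t → N.StateInH1 (z t)
  hasDeriv : ∀ t, 0 ≤ t → ∀ e k,
    HasDerivWithinAt (fun s => toL2 (volume.restrict (Icc 0 (N.len e))) (z s e k))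
      (toL2 (volume.restrict (Icc 0 (N.len e))) (N.op (z t) e k)) (Ici 0) t
  voltage : ∀ t, 0 ≤ t → ∀ p q, N.node p = N.node q →
    N.endVoltage (z t) p = N.endVoltage (z t) q
  generator : ∀ t, 0 ≤ t → ∀ p, N.node p ∈ N.gen → N.endVoltage (z t) p = vg (N.node p) t
  load : ∀ t, 0 ≤ t → ∀ l, l ∉ N.gen →
    ∑ p with N.node p = l, N.sgn p * N.endCurrent (z t) p = il l t

section Coupling

variable [Fintype E] [DecidableEq V] {vg il vg' il' : V → ℝ → ℝ} {z w : ℝ → NetState E}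

lemma IsSolution.isTrajectory {u₀ : NetState E} (h : N.IsSolution vg il u₀ z) :
    N.IsTrajectory vg il z where
  mem_H1 := h.mem_H1
  hasDeriv t ht e k := hasDerivWithinAt_toL2 (f := fun s => z s e k) ht
    (fun r hr => (h.mem_H1 r hr).memLp e k)
    ((h.mem_H1 t ht).memLp_op e k) (h.evolution t ht e k)
  voltage := h.voltage_continuous
  generator := h.generator
  load := h.load

lemma IsTrajectory.sub (hz : N.IsTrajectory vg il z) (hw : N.IsTrajectory vg' il' w) :
    N.IsTrajectory (vg - vg') (il - il') (z - w) where
  mem_H1 t ht := (hz.mem_H1 t ht).sub (hw.mem_H1 t ht)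
  hasDeriv t ht e k := by
    have hz1 := hz.mem_H1 t ht
    have hw1 := hw.mem_H1 t ht
    rw [show (z - w) t = z t - w t from rfl,
      toL2_congr_ae ((hz1.sub hw1).memLp_op e k) (hz1.op_sub_ae hw1 e k),
      toL2_sub (hz1.memLp_op e k) (hw1.memLp_op e k)]
    refine ((hz.hasDeriv t ht e k).sub (hw.hasDeriv t ht e k)).congr_of_mem (fun s hs => ?_) ht
    exact toL2_sub ((hz.mem_H1 s hs).memLp e k) ((hw.mem_H1 s hs).memLp e k)
  voltage t ht p q hpq := congrArg₂ (· - ·) (hz.voltage t ht p q hpq) (hw.voltage t ht p q hpq)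
  generator t ht p hp := congrArg₂ (· - ·) (hz.generator t ht p hp) (hw.generator t ht p hp)
  load t ht l hl := by
    rw [show (il - il') l t = il l t - il' l t from rfl, ← hz.load t ht l hl, ← hw.load t ht l hl,
      ← Finset.sum_sub_distrib]
    exact Finset.sum_congr rfl fun p _ => mul_sub _ _ _

/-- The network problem is autonomous. -/
lemma IsTrajectory.shift (hz : N.IsTrajectory vg il z) {h : ℝ} (hh : 0 ≤ h) :
    N.IsTrajectory (fun v t => vg v (t + h)) (fun v t => il v (t + h)) (fun t => z (t + h)) where
  mem_H1 t ht := hz.mem_H1 (t + h) (add_nonneg ht hh)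
  hasDeriv t ht e k := by
    have h1 := hz.hasDeriv (t + h) (add_nonneg ht hh) e k
    have h2 : HasDerivWithinAt (fun s : ℝ => s + h) 1 (Ici 0) t :=
      ((hasDerivAt_id t).add_const h).hasDerivWithinAt
    have h3 := HasDerivWithinAt.scomp t h1 h2 (fun s hs => add_nonneg hs hh)
    simpa [Function.comp_def] using h3
  voltage t ht := hz.voltage (t + h) (add_nonneg ht hh)
  generator t ht := hz.generator (t + h) (add_nonneg ht hh)
  load t ht := hz.load (t + h) (add_nonneg ht hh)

/-- With homogeneous coupling conditions, the network exchanges no power with the outside. -/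
lemma sum_power_eq_zero {z : NetState E}
    (hv : ∀ p q, N.node p = N.node q → N.endVoltage z p = N.endVoltage z q)
    (hg : ∀ p, N.node p ∈ N.gen → N.endVoltage z p = 0)
    (hl : ∀ l ∉ N.gen, ∑ p with N.node p = l, N.sgn p * N.endCurrent z p = 0) :
    ∑ e, (z e 0 (N.len e) * z e 1 (N.len e) - z e 0 0 * z e 1 0) = 0 := by
  have h1 : ∑ e, (z e 0 (N.len e) * z e 1 (N.len e) - z e 0 0 * z e 1 0)
      = ∑ p, N.endVoltage z p * (N.sgn p * N.endCurrent z p) := by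
    rw [Fintype.sum_prod_type]
    refine Finset.sum_congr rfl fun e _ => ?_
    simp only [Fintype.sum_bool, endVoltage, endCurrent, sgn, pos]
    ring
  rw [h1, ← Finset.sum_fiberwise_of_maps_to (t := Finset.univ.image N.node) (g := N.node)
    (fun p hp => Finset.mem_image_of_mem _ hp)]
  refine Finset.sum_eq_zero fun v hv' => ?_
  obtain ⟨q, -, rfl⟩ := Finset.mem_image.1 hv'
  have h2 : ∑ p with N.node p = N.node q, N.endVoltage z p * (N.sgn p * N.endCurrent z p)
      = N.endVoltage z q * ∑ p with N.node p = N.node q, N.sgn p * N.endCurrent z p := by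
    rw [Finset.mul_sum]
    refine Finset.sum_congr rfl fun p hp => ?_
    rw [hv p q (Finset.mem_filter.1 hp).2]
  rw [h2]
  by_cases hq : N.node q ∈ N.gen
  · rw [hg q hq, zero_mul]
  · rw [hl _ hq, mul_zero]

end Coupling

/-! ### The energy -/

/-- Twice the electromagnetic energy on the line `e`. -/
noncomputable def lineEnergy (N : PowerNetwork V E) (z : NetState E) (e : E) : ℝ :=
  N.C e * (∫ x in Icc 0 (N.len e), z e 0 x ^ 2) + N.L e * ∫ x in Icc 0 (N.len e), z e 1 x ^ 2

/-- Twice the electromagnetic energy of a state. -/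
noncomputable def energy [Fintype E] (N : PowerNetwork V E) (z : NetState E) : ℝ :=
  ∑ e, N.lineEnergy z e

lemma lineEnergy_nonneg (z : NetState E) (e : E) : 0 ≤ N.lineEnergy z e :=
  add_nonneg (mul_nonneg (N.C_pos e).le (integral_nonneg fun _ => sq_nonneg _))
    (mul_nonneg (N.L_pos e).le (integral_nonneg fun _ => sq_nonneg _))

lemma lineEnergy_eq_norm {z : NetState E} {e : E}
    (hz : ∀ k, MemLp (z e k) 2 (volume.restrict (Icc 0 (N.len e)))) :
    N.lineEnergy z e = N.C e * ‖toL2 (volume.restrict (Icc 0 (N.len e))) (z e 0)‖ ^ 2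
      + N.L e * ‖toL2 (volume.restrict (Icc 0 (N.len e))) (z e 1)‖ ^ 2 := by
  rw [lineEnergy, norm_sq_toL2 (hz 0), norm_sq_toL2 (hz 1)]

/-- The power balance on a line: the energy changes by the power flowing through the two ends and
by the losses in `G` and `R`. -/
lemma StateInH1.integral_mul_op {z : NetState E} (hz : N.StateInH1 z) (e : E) :
    N.C e * (∫ x in Icc 0 (N.len e), z e 0 x * N.op z e 0 x)
        + N.L e * (∫ x in Icc 0 (N.len e), z e 1 x * N.op z e 1 x)
      = -(z e 0 (N.len e) * z e 1 (N.len e) - z e 0 0 * z e 1 0)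
        - (N.G e * (∫ x in Icc 0 (N.len e), z e 0 x ^ 2)
          + N.R e * ∫ x in Icc 0 (N.len e), z e 1 x ^ 2) := by
  have m := hz.memLp e
  have i0 := (m 0).integrable_sq
  have i1 := (m 1).integrable_sq
  have j0 : Integrable (fun x => z e 0 x * N.op z e 0 x) (volume.restrict (Icc 0 (N.len e))) :=
    (m 0).integrable_mul (hz.memLp_op e 0)
  have j1 : Integrable (fun x => z e 1 x * N.op z e 1 x) (volume.restrict (Icc 0 (N.len e))) :=
    (m 1).integrable_mul (hz.memLp_op e 1)
  have k0 : Integrable (fun x => deriv (z e 0) x * z e 1 x)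
    (volume.restrict (Icc 0 (N.len e))) := (hz e 0).2.integrable_mul (m 1)
  have k1 : Integrable (fun x => z e 0 x * deriv (z e 1) x)
    (volume.restrict (Icc 0 (N.len e))) := (m 0).integrable_mul (hz e 1).2
  have kk : Integrable (fun x => -(deriv (z e 0) x * z e 1 x + z e 0 x * deriv (z e 1) x))
    (volume.restrict (Icc 0 (N.len e))) := (k0.add k1).neg
  have ii : Integrable (fun x => N.G e * z e 0 x ^ 2 + N.R e * z e 1 x ^ 2)
    (volume.restrict (Icc 0 (N.len e))) := (i0.const_mul _).add (i1.const_mul _)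
  rw [← (hz e 0).integral_mul_deriv_add (N.len_pos e).le (hz e 1), ← integral_const_mul,
    ← integral_const_mul, ← integral_const_mul, ← integral_const_mul,
    ← integral_add (j0.const_mul _) (j1.const_mul _),
    ← integral_add (i0.const_mul _) (i1.const_mul _), ← integral_neg,
    ← integral_sub kk ii]
  refine integral_congr_ae (ae_of_all _ fun x => ?_)
  have hC := (N.C_pos e).ne'
  have hL := (N.L_pos e).ne'
  simp only [op_zero, op_one]
  field_simp
  ring

section Trajectory

variable [Fintype E] [DecidableEq V] {z : ℝ → NetState E}

/-- The rate of change of the energy along a trajectory with homogeneous coupling conditions: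
only the losses in the lines remain. -/
lemma IsTrajectory.hasDerivWithinAt_energy (hz : N.IsTrajectory 0 0 z) {t : ℝ} (ht : 0 ≤ t) :
    HasDerivWithinAt (fun s => N.energy (z s))
      (-2 * ∑ e, (N.G e * (∫ x in Icc 0 (N.len e), z t e 0 x ^ 2)
        + N.R e * ∫ x in Icc 0 (N.len e), z t e 1 x ^ 2)) (Ici 0) t := by
  have ht1 := hz.mem_H1 t ht
  have h1 : HasDerivWithinAt (fun s => N.energy (z s))
      (∑ e, (N.C e * (2 * ∫ x in Icc 0 (N.len e), z t e 0 x * N.op (z t) e 0 x)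
        + N.L e * (2 * ∫ x in Icc 0 (N.len e), z t e 1 x * N.op (z t) e 1 x))) (Ici 0) t := by
    refine HasDerivWithinAt.fun_sum fun e _ => ?_
    refine HasDerivWithinAt.congr_of_mem ?_
      (fun s hs => lineEnergy_eq_norm ((hz.mem_H1 s hs).memLp e)) ht
    rw [← inner_toL2 (ht1.memLp e 0) (ht1.memLp_op e 0),
      ← inner_toL2 (ht1.memLp e 1) (ht1.memLp_op e 1)]
    exact ((hz.hasDeriv t ht e 0).norm_sq.const_mul _).add
      ((hz.hasDeriv t ht e 1).norm_sq.const_mul _)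
  convert h1 using 1
  have h2 := sum_power_eq_zero (hz.voltage t ht) (hz.generator t ht) (hz.load t ht)
  have h3 := Finset.sum_congr rfl fun e (_ : e ∈ Finset.univ) => ht1.integral_mul_op e
  rw [Finset.sum_sub_distrib, Finset.sum_neg_distrib, h2, neg_zero, zero_sub] at h3
  rw [neg_mul, ← mul_neg, ← h3, Finset.mul_sum]
  exact Finset.sum_congr rfl fun e _ => by ring

/-- Exponential decay of the energy: `exp (2 μ t) * energy (z t)` is nonincreasing. -/
lemma IsTrajectory.energy_le (hz : N.IsTrajectory 0 0 z) {μ : ℝ}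
    (hμG : ∀ e, μ * N.C e ≤ N.G e) (hμR : ∀ e, μ * N.L e ≤ N.R e) {t : ℝ} (ht : 0 ≤ t) :
    N.energy (z t) ≤ Real.exp (-μ * t) ^ 2 * N.energy (z 0) := by
  have hd : ∀ s ∈ Ici (0 : ℝ), HasDerivWithinAt (fun s => Real.exp (2 * μ * s) * N.energy (z s))
      _ (Ici 0) s := fun s hs =>
    (((hasDerivAt_id s).const_mul (2 * μ)).exp.hasDerivWithinAt).mul (hz.hasDerivWithinAt_energy hs)
  have hanti : AntitoneOn (fun s => Real.exp (2 * μ * s) * N.energy (z s)) (Ici 0) := by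
    refine antitoneOn_of_deriv_nonpos (convex_Ici 0) (fun s hs => (hd s hs).continuousWithinAt)
      (fun s hs => ((hd s (interior_subset hs)).mono interior_subset).differentiableWithinAt)
      fun s hs => ?_
    rw [((hd s (interior_subset hs)).hasDerivAt (mem_interior_iff_mem_nhds.1 hs)).deriv]
    have h1 : μ * N.energy (z s) ≤ ∑ e, (N.G e * (∫ x in Icc 0 (N.len e), z s e 0 x ^ 2)
        + N.R e * ∫ x in Icc 0 (N.len e), z s e 1 x ^ 2) := by
      rw [energy, Finset.mul_sum]
      refine Finset.sum_le_sum fun e _ => ?_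
      rw [lineEnergy, mul_add, ← mul_assoc, ← mul_assoc]
      exact add_le_add
        (mul_le_mul_of_nonneg_right (hμG e) (integral_nonneg fun _ => sq_nonneg _))
        (mul_le_mul_of_nonneg_right (hμR e) (integral_nonneg fun _ => sq_nonneg _))
    have h2 := mul_le_mul_of_nonneg_left h1 (Real.exp_pos (2 * μ * s)).le
    simp only [id]
    linarith
  have h := hanti self_mem_Ici (mem_Ici.2 ht) ht
  simp only [mul_zero, Real.exp_zero, one_mul] at h
  rw [show Real.exp (-μ * t) ^ 2 = (Real.exp (2 * μ * t))⁻¹ by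
    rw [← Real.exp_nat_mul, ← Real.exp_neg]; congr 1; push_cast; ring]
  rwa [← div_eq_inv_mul, le_div_iff₀' (Real.exp_pos _)]

/-- The energy of the difference quotients in time tends to the energy of the time derivative. -/
lemma IsTrajectory.tendsto_energy {vg il : V → ℝ → ℝ} (hz : N.IsTrajectory vg il z) {t : ℝ}
    (ht : 0 ≤ t) :
    Tendsto (fun h => (h⁻¹) ^ 2 * N.energy (z (t + h) - z t)) (𝓝[>] 0)
      (𝓝 (N.energy (N.op (z t)))) := by
  have ht1 := hz.mem_H1 t ht
  have hmap : Tendsto (fun h : ℝ => t + h) (𝓝[>] 0) (𝓝[Ici 0 \ {t}] t) := by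
    refine tendsto_nhdsWithin_iff.2 ⟨?_, ?_⟩
    · refine Tendsto.mono_left ?_ nhdsWithin_le_nhds
      exact (by fun_prop : Continuous fun h : ℝ => t + h).tendsto' 0 t (add_zero t)
    · filter_upwards [self_mem_nhdsWithin] with h hh
      have hh' : 0 < h := hh
      exact ⟨(by positivity : 0 ≤ t + h), by simp [hh'.ne']⟩
  have hs := fun e k => ((hasDerivWithinAt_iff_tendsto_slope.1 (hz.hasDeriv t ht e k)).comp
    hmap).norm.pow 2
  have hlim : Tendsto (fun h => ∑ e, (N.C e * _ + N.L e * _)) (𝓝[>] (0 : ℝ)) (𝓝 _) :=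
    tendsto_finsetSum Finset.univ fun e _ =>
      ((hs e 0).const_mul (N.C e)).add ((hs e 1).const_mul (N.L e))
  have heq : N.energy (N.op (z t)) = _ :=
    Finset.sum_congr rfl fun e _ => lineEnergy_eq_norm (ht1.memLp_op e)
  rw [heq]
  refine hlim.congr' ?_
  filter_upwards [self_mem_nhdsWithin] with h hh
  have hth : 0 ≤ t + h := add_nonneg ht (le_of_lt hh)
  have hth1 := hz.mem_H1 _ hth
  rw [energy, Finset.mul_sum]
  refine Finset.sum_congr rfl fun e _ => ?_
  rw [lineEnergy_eq_norm ((hth1.sub ht1).memLp e)]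
  have hk : ∀ k, (z (t + h) - z t) e k = z (t + h) e k - z t e k := fun _ => rfl
  simp only [hk, Function.comp_apply, slope_def_module, add_sub_cancel_left, norm_smul, mul_pow,
    toL2_sub (hth1.memLp e _) (ht1.memLp e _), norm_inv, inv_pow, Real.norm_eq_abs, sq_abs]
  ring

/-- The energy of the time derivative decays as well: the differences of a trajectory and its time
shifts are trajectories, to which the decay of the energy applies. -/
lemma IsTrajectory.energy_op_le (hz : N.IsTrajectory 0 0 z) {μ : ℝ}
    (hμG : ∀ e, μ * N.C e ≤ N.G e) (hμR : ∀ e, μ * N.L e ≤ N.R e) {t : ℝ} (ht : 0 ≤ t) :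
    N.energy (N.op (z t)) ≤ Real.exp (-μ * t) ^ 2 * N.energy (N.op (z 0)) := by
  refine le_of_tendsto_of_tendsto (hz.tendsto_energy ht)
    ((hz.tendsto_energy le_rfl).const_mul _) ?_
  filter_upwards [self_mem_nhdsWithin] with h hh
  have hdiff : N.IsTrajectory 0 0 ((fun s => z (s + h)) - z) := by
    have := (hz.shift (le_of_lt hh)).sub hz
    simpa [Pi.zero_def, Pi.sub_def] using this
  have h1 := mul_le_mul_of_nonneg_left (hdiff.energy_le hμG hμR ht) (sq_nonneg h⁻¹)
  simp only [Pi.sub_apply] at h1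
  linarith

end Trajectory

/-! ### Energies and the `H¹` norm -/

/-- The square of the `H¹` norm of a state on the line `e`. -/
noncomputable def lineH1Sq (N : PowerNetwork V E) (z : NetState E) (e : E) : ℝ :=
  ∑ k, ((∫ x in Icc 0 (N.len e), z e k x ^ 2) + ∫ x in Icc 0 (N.len e), deriv (z e k) x ^ 2)

lemma lineH1Sq_nonneg (z : NetState E) (e : E) : 0 ≤ N.lineH1Sq z e :=
  Finset.sum_nonneg fun _ _ => add_nonneg (integral_nonneg fun _ => sq_nonneg _)
    (integral_nonneg fun _ => sq_nonneg _)

lemma h1Norm_sq_eq_sum_lineH1Sq [Fintype E] {z₀ z : NetState E} (hz : N.StateInH1 z)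
    (h : ∀ e k, ∀ x ∈ Icc 0 (N.len e), z₀ e k x = z e k x) :
    N.h1Norm z₀ ^ 2 = ∑ e, N.lineH1Sq z e := by
  have key : ∀ e k, ∫ x in (0 : ℝ)..N.len e, ((z₀ e k x) ^ 2 + (deriv (z₀ e k) x) ^ 2)
      = (∫ x in Icc 0 (N.len e), z e k x ^ 2)
        + ∫ x in Icc 0 (N.len e), deriv (z e k) x ^ 2 := by
    intro e k
    have i1 := (hz.memLp e k).integrable_sq
    have i2 := (hz e k).2.integrable_sq
    rw [← integral_add i1 i2, integral_Icc_eq_integral_Ioo,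
      intervalIntegral.integral_of_le (N.len_pos e).le, integral_Ioc_eq_integral_Ioo]
    refine setIntegral_congr_fun measurableSet_Ioo fun x hx => ?_
    have h1 : z₀ e k =ᶠ[𝓝 x] z e k := by
      filter_upwards [isOpen_Ioo.mem_nhds hx] with y hy using h e k y (Ioo_subset_Icc_self hy)
    simp only [h1.deriv_eq, h1.eq_of_nhds]
  simp only [h1Norm, key]
  exact Real.sq_sqrt (Finset.sum_nonneg fun e _ => lineH1Sq_nonneg z e)

/-- The equations recover `∂ₓ z` from `z` and `op z`. -/
lemma StateInH1.lineH1Sq_le {z : NetState E} (hz : N.StateInH1 z) (e : E) :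
    N.lineH1Sq z e ≤ ((1 + 2 * N.G e ^ 2) / N.C e + (1 + 2 * N.R e ^ 2) / N.L e
      + 2 * N.C e + 2 * N.L e) * (N.lineEnergy z e + N.lineEnergy (N.op z) e) := by
  have hC := N.C_pos e
  have hL := N.L_pos e
  have i := fun k => (hz.memLp e k).integrable_sq
  have j := fun k => (hz.memLp_op e k).integrable_sq
  have d0 : ∫ x in Icc 0 (N.len e), deriv (z e 0) x ^ 2 ≤
      2 * N.L e ^ 2 * (∫ x in Icc 0 (N.len e), N.op z e 1 x ^ 2)
        + 2 * N.R e ^ 2 * ∫ x in Icc 0 (N.len e), z e 1 x ^ 2 := by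
    rw [← integral_const_mul, ← integral_const_mul,
      ← integral_add ((j 1).const_mul _) ((i 1).const_mul _)]
    refine integral_mono (hz e 0).2.integrable_sq
      (((j 1).const_mul _).add ((i 1).const_mul _)) fun x => ?_
    have hx : deriv (z e 0) x = -(N.L e * N.op z e 1 x) - N.R e * z e 1 x := by
      simp only [op_one]; field_simp; ring
    simp only [hx]
    nlinarith [sq_nonneg (N.L e * N.op z e 1 x - N.R e * z e 1 x)]
  have d1 : ∫ x in Icc 0 (N.len e), deriv (z e 1) x ^ 2 ≤
      2 * N.C e ^ 2 * (∫ x in Icc 0 (N.len e), N.op z e 0 x ^ 2)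
        + 2 * N.G e ^ 2 * ∫ x in Icc 0 (N.len e), z e 0 x ^ 2 := by
    rw [← integral_const_mul, ← integral_const_mul,
      ← integral_add ((j 0).const_mul _) ((i 0).const_mul _)]
    refine integral_mono (hz e 1).2.integrable_sq
      (((j 0).const_mul _).add ((i 0).const_mul _)) fun x => ?_
    have hx : deriv (z e 1) x = -(N.C e * N.op z e 0 x) - N.G e * z e 0 x := by
      simp only [op_zero]; field_simp; ring
    simp only [hx]
    nlinarith [sq_nonneg (N.C e * N.op z e 0 x - N.G e * z e 0 x)]
  have n0 : 0 ≤ N.C e * ∫ x in Icc 0 (N.len e), z e 0 x ^ 2 :=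
    mul_nonneg hC.le (integral_nonneg fun _ => sq_nonneg _)
  have n1 : 0 ≤ N.L e * ∫ x in Icc 0 (N.len e), z e 1 x ^ 2 :=
    mul_nonneg hL.le (integral_nonneg fun _ => sq_nonneg _)
  have n2 : 0 ≤ N.C e * ∫ x in Icc 0 (N.len e), N.op z e 0 x ^ 2 :=
    mul_nonneg hC.le (integral_nonneg fun _ => sq_nonneg _)
  have n3 : 0 ≤ N.L e * ∫ x in Icc 0 (N.len e), N.op z e 1 x ^ 2 :=
    mul_nonneg hL.le (integral_nonneg fun _ => sq_nonneg _)
  simp only [lineH1Sq, lineEnergy, Fin.sum_univ_two]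
  generalize (∫ x in Icc 0 (N.len e), z e 0 x ^ 2) = a0 at *
  generalize (∫ x in Icc 0 (N.len e), z e 1 x ^ 2) = a1 at *
  generalize (∫ x in Icc 0 (N.len e), N.op z e 0 x ^ 2) = b0 at *
  generalize (∫ x in Icc 0 (N.len e), N.op z e 1 x ^ 2) = b1 at *
  have e0 : (1 + 2 * N.G e ^ 2) / N.C e * (N.C e * a0) = a0 + 2 * N.G e ^ 2 * a0 := by
    field_simp
  have e1 : (1 + 2 * N.R e ^ 2) / N.L e * (N.L e * a1) = a1 + 2 * N.R e ^ 2 * a1 := by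
    field_simp
  set α := (1 + 2 * N.G e ^ 2) / N.C e
  set β := (1 + 2 * N.R e ^ 2) / N.L e
  have hα : 0 ≤ α := by positivity
  have hβ : 0 ≤ β := by positivity
  -- Of the products of the four coefficients with the four parts of the energies, one for each
  -- coefficient is needed, and the others are nonnegative.
  have t0 := mul_nonneg hα (add_nonneg n1 (add_nonneg n2 n3))
  have t1 := mul_nonneg hβ (add_nonneg n0 (add_nonneg n2 n3))
  have t2 := mul_nonneg hC.le (add_nonneg n0 (add_nonneg n1 n3))
  have t3 := mul_nonneg hL.le (add_nonneg n0 (add_nonneg n1 n2))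
  linarith

/-- The converse of `StateInH1.lineH1Sq_le`, up to the constant. -/
lemma StateInH1.lineEnergy_add_le {z : NetState E} (hz : N.StateInH1 z) (e : E) :
    N.lineEnergy z e + N.lineEnergy (N.op z) e ≤ ((N.C e + 2 * N.G e ^ 2 / N.C e)
      + (N.L e + 2 * N.R e ^ 2 / N.L e) + 2 / N.C e + 2 / N.L e) * N.lineH1Sq z e := by
  have hC := N.C_pos e
  have hL := N.L_pos e
  have i := fun k => (hz.memLp e k).integrable_sq
  have j := fun k => (hz e k).2.integrable_sq
  have d0 : N.C e * ∫ x in Icc 0 (N.len e), N.op z e 0 x ^ 2 ≤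
      2 / N.C e * (∫ x in Icc 0 (N.len e), deriv (z e 1) x ^ 2)
        + 2 * N.G e ^ 2 / N.C e * ∫ x in Icc 0 (N.len e), z e 0 x ^ 2 := by
    rw [← integral_const_mul, ← integral_const_mul, ← integral_const_mul,
      ← integral_add ((j 1).const_mul _) ((i 0).const_mul _)]
    refine integral_mono ((hz.memLp_op e 0).integrable_sq.const_mul _)
      (((j 1).const_mul _).add ((i 0).const_mul _)) fun x => ?_
    simp only [op_zero]
    rw [← sub_nonneg]
    have : 0 ≤ (deriv (z e 1) x - N.G e * z e 0 x) ^ 2 / N.C e := by positivity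
    refine this.trans_eq ?_
    field_simp
    ring
  have d1 : N.L e * ∫ x in Icc 0 (N.len e), N.op z e 1 x ^ 2 ≤
      2 / N.L e * (∫ x in Icc 0 (N.len e), deriv (z e 0) x ^ 2)
        + 2 * N.R e ^ 2 / N.L e * ∫ x in Icc 0 (N.len e), z e 1 x ^ 2 := by
    rw [← integral_const_mul, ← integral_const_mul, ← integral_const_mul,
      ← integral_add ((j 0).const_mul _) ((i 1).const_mul _)]
    refine integral_mono ((hz.memLp_op e 1).integrable_sq.const_mul _)
      (((j 0).const_mul _).add ((i 1).const_mul _)) fun x => ?_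
    simp only [op_one]
    rw [← sub_nonneg]
    have : 0 ≤ (deriv (z e 0) x - N.R e * z e 1 x) ^ 2 / N.L e := by positivity
    refine this.trans_eq ?_
    field_simp
    ring
  have n0 : 0 ≤ ∫ x in Icc 0 (N.len e), z e 0 x ^ 2 := integral_nonneg fun _ => sq_nonneg _
  have n1 : 0 ≤ ∫ x in Icc 0 (N.len e), z e 1 x ^ 2 := integral_nonneg fun _ => sq_nonneg _
  have n2 : 0 ≤ ∫ x in Icc 0 (N.len e), deriv (z e 0) x ^ 2 :=
    integral_nonneg fun _ => sq_nonneg _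
  have n3 : 0 ≤ ∫ x in Icc 0 (N.len e), deriv (z e 1) x ^ 2 :=
    integral_nonneg fun _ => sq_nonneg _
  simp only [lineH1Sq, lineEnergy, Fin.sum_univ_two]
  generalize (∫ x in Icc 0 (N.len e), z e 0 x ^ 2) = a0 at *
  generalize (∫ x in Icc 0 (N.len e), z e 1 x ^ 2) = a1 at *
  generalize (∫ x in Icc 0 (N.len e), deriv (z e 0) x ^ 2) = b0 at *
  generalize (∫ x in Icc 0 (N.len e), deriv (z e 1) x ^ 2) = b1 at *
  set α := 2 * N.G e ^ 2 / N.C e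
  set β := 2 * N.R e ^ 2 / N.L e
  set γ := 2 / N.C e
  set δ := 2 / N.L e
  have hα : 0 ≤ N.C e + α := by positivity
  have hβ : 0 ≤ N.L e + β := by positivity
  have hγ : 0 ≤ γ := by positivity
  have hδ : 0 ≤ δ := by positivity
  have t0 := mul_nonneg hα (add_nonneg n1 (add_nonneg n2 n3))
  have t1 := mul_nonneg hβ (add_nonneg n0 (add_nonneg n2 n3))
  have t2 := mul_nonneg hγ (add_nonneg n0 (add_nonneg n1 n2))
  have t3 := mul_nonneg hδ (add_nonneg n0 (add_nonneg n1 n3))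
  linarith

/-- The bound is positive also if `ι` is empty or all the values are negative. -/
lemma exists_pos_forall_le {ι : Type*} [Finite ι] (f : ι → ℝ) : ∃ M > 0, ∀ i, f i ≤ M := by
  obtain ⟨M, hM⟩ := (Set.finite_range f).bddAbove
  exact ⟨max M 1, lt_max_of_lt_right one_pos, fun i => (hM ⟨i, rfl⟩).trans (le_max_left _ _)⟩

/-- The energies of a state and of its time derivative together bound the supremum norm. -/
lemma exists_sq_le_energy [Fintype E] (N : PowerNetwork V E) :
    ∃ M > 0, ∀ z : NetState E, N.StateInH1 z → ∀ e k, ∀ x ∈ Icc 0 (N.len e),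
      z e k x ^ 2 ≤ M * (N.energy z + N.energy (N.op z)) := by
  obtain ⟨M, hM, h⟩ := exists_pos_forall_le fun e : E => (1 / N.len e + 1) *
    ((1 + 2 * N.G e ^ 2) / N.C e + (1 + 2 * N.R e ^ 2) / N.L e + 2 * N.C e + 2 * N.L e)
  refine ⟨M, hM, fun z hz e k x hx => ?_⟩
  have hℓ := N.len_pos e
  have hk : (∫ x in Icc 0 (N.len e), z e k x ^ 2) + ∫ x in Icc 0 (N.len e), deriv (z e k) x ^ 2
      ≤ N.lineH1Sq z e :=
    Finset.single_le_sum (f := fun k => (∫ x in Icc 0 (N.len e), z e k x ^ 2)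
      + ∫ x in Icc 0 (N.len e), deriv (z e k) x ^ 2)
      (fun _ _ => add_nonneg (integral_nonneg fun _ => sq_nonneg _)
        (integral_nonneg fun _ => sq_nonneg _)) (Finset.mem_univ k)
  have hle : ∀ z : NetState E, N.lineEnergy z e ≤ N.energy z := fun z =>
    Finset.single_le_sum (f := N.lineEnergy z) (fun _ _ => lineEnergy_nonneg _ _)
      (Finset.mem_univ e)
  calc z e k x ^ 2 ≤ (1 / N.len e + 1) * _ := (hz e k).sq_le hℓ hx
    _ ≤ (1 / N.len e + 1) * (_ * (N.lineEnergy z e + N.lineEnergy (N.op z) e)) :=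
        mul_le_mul_of_nonneg_left (hk.trans (hz.lineH1Sq_le e)) (by positivity)
    _ ≤ M * (N.lineEnergy z e + N.lineEnergy (N.op z) e) := by
        rw [← mul_assoc]
        exact mul_le_mul_of_nonneg_right (h e)
          (add_nonneg (lineEnergy_nonneg _ _) (lineEnergy_nonneg _ _))
    _ ≤ M * (N.energy z + N.energy (N.op z)) :=
        mul_le_mul_of_nonneg_left (add_le_add (hle _) (hle _)) hM.le

lemma exists_energy_le_lineH1Sq [Fintype E] (N : PowerNetwork V E) :
    ∃ D > 0, ∀ z : NetState E, N.StateInH1 z →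
      N.energy z + N.energy (N.op z) ≤ D * ∑ e, N.lineH1Sq z e := by
  obtain ⟨D, hD, h⟩ := exists_pos_forall_le fun e : E => (N.C e + 2 * N.G e ^ 2 / N.C e)
      + (N.L e + 2 * N.R e ^ 2 / N.L e) + 2 / N.C e + 2 / N.L e
  refine ⟨D, hD, fun z hz => ?_⟩
  rw [energy, energy, ← Finset.sum_add_distrib, Finset.mul_sum]
  exact Finset.sum_le_sum fun e _ => (hz.lineEnergy_add_le e).trans
    (mul_le_mul_of_nonneg_right (h e) (lineH1Sq_nonneg z e))

/-- The damping rates `G / C` and `R / L` of all the lines have a common positive lower bound. -/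
lemma exists_damping_rate [Finite E] (N : PowerNetwork V E) :
    ∃ μ > 0, (∀ e, μ * N.C e ≤ N.G e) ∧ ∀ e, μ * N.L e ≤ N.R e := by
  obtain ⟨M, hM, h⟩ := exists_pos_forall_le fun e : E => max (N.C e / N.G e) (N.L e / N.R e)
  refine ⟨M⁻¹, inv_pos.2 hM, fun e => ?_, fun e => ?_⟩
  · rw [inv_mul_le_iff₀ hM, ← div_le_iff₀ (N.G_pos e)]
    exact (le_max_left _ _).trans (h e)
  · rw [inv_mul_le_iff₀ hM, ← div_le_iff₀ (N.R_pos e)]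
    exact (le_max_right _ _).trans (h e)

end PowerNetwork

theorem mainTheorem5 {V E : Type*} [Fintype V] [DecidableEq V] [Fintype E]
    (N : PowerNetwork V E) (R L G C : ℝ)
    (hR : ∀ e, N.R e = R) (hL : ∀ e, N.L e = L) (hG : ∀ e, N.G e = G) (hC : ∀ e, N.C e = C) :
    ∃ K > (0 : ℝ), ∃ μ > (0 : ℝ),
      ∀ vg il : V → ℝ → ℝ,
        (∀ g ∈ N.gen, ContDiffOn ℝ 1 (vg g) (Ici 0)) →
        (∀ l ∉ N.gen, ContDiffOn ℝ 1 (il l) (Ici 0)) →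
        ∀ u₀ w₀ : NetState E, N.StateInH2 u₀ → N.StateInH2 w₀ →
          ∀ u w : ℝ → NetState E, N.IsSolution vg il u₀ u → N.IsSolution vg il w₀ w →
            ∀ t, 0 ≤ t → ∀ e k, ∀ x ∈ Icc 0 (N.len e),
              |u t e k x - w t e k x| ≤ K * Real.exp (-μ * t) * N.h1Norm (u₀ - w₀) := by
  obtain ⟨μ, hμ, hμG, hμR⟩ := N.exists_damping_rate
  obtain ⟨M, hM, hsup⟩ := N.exists_sq_le_energy
  obtain ⟨D, hD, hinit⟩ := N.exists_energy_le_lineH1Sq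
  refine ⟨√(M * D), by positivity, μ, hμ, ?_⟩
  intro vg il _ _ u₀ w₀ _ _ u w hu hw t ht e k x hx
  have hz : N.IsTrajectory 0 0 (u - w) := by
    simpa only [sub_self] using hu.isTrajectory.sub hw.isTrajectory
  have hnorm := N.h1Norm_sq_eq_sum_lineH1Sq (z₀ := u₀ - w₀) (hz.mem_H1 0 le_rfl)
    fun e k x hx => congrArg₂ (· - ·) (hu.initial e k x hx).symm (hw.initial e k x hx).symm
  refine abs_le_of_sq_le_sq ?_ (mul_nonneg (by positivity) (Real.sqrt_nonneg _))
  calc (u t e k x - w t e k x) ^ 2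
      ≤ M * (N.energy ((u - w) t) + N.energy (N.op ((u - w) t))) :=
        hsup _ (hz.mem_H1 t ht) e k x hx
    _ ≤ M * (Real.exp (-μ * t) ^ 2 * (D * N.h1Norm (u₀ - w₀) ^ 2)) := by
        refine mul_le_mul_of_nonneg_left ?_ hM.le
        refine (add_le_add (hz.energy_le hμG hμR ht) (hz.energy_op_le hμG hμR ht)).trans ?_
        rw [← mul_add, hnorm]
        exact mul_le_mul_of_nonneg_left (hinit _ (hz.mem_H1 0 le_rfl)) (sq_nonneg _)
    _ = (√(M * D) * Real.exp (-μ * t) * N.h1Norm (u₀ - w₀)) ^ 2 := by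
        rw [mul_pow, mul_pow, Real.sq_sqrt (mul_pos hM hD).le]; ring
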